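/- Let $H_0^{(1)}=J_0+iY_0$ be the Hankel function of the first kind of order zero. For $\omega>0$ and $\beta\in\mathbb{R}$ let $$\sigma_n^{(1)}=\int_0^1 T_n(2x-1)\,H_0^{(1)}(\omega x)\,e^{i\omega\beta x}\,dx ,\qquad n\ge 0,$$ where $T_n$ is the $n$-th Chebyshev polynomial of the first kind, so that $T_0=1$ and $\sigma_0^{(1)}=\int_0^1 H_0^{(1)}(\omega x)e^{i\omega\beta x}\,dx$. Then for all $\omega>0$ and $\beta\in\mathbb{R}$ $$\sigma_0^{(1)}=-\frac{2i}{\pi}\,\omega^{-1}\int_0^\infty \frac{1}{\sqrt t}\,\frac{e^{i(\beta+1)\omega}e^{-t\omega}-1}{\sqrt{2i-t}\,(1+\beta+it)}\,dt ,$$ where $\sqrt{\cdot}$ is the branch of the square root with nonnegative real part, and both integrals converge absolutely. -/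

import Mathlib

noncomputable section

/-- The Bessel function of the first kind of order zero,
`J₀(z) = ∑_{k ≥ 0} (-1)^k (z²/4)^k / (k!)²`. -/
def besselJZero (z : ℂ) : ℂ :=
  ∑' k : ℕ, (-1 : ℂ) ^ k * (z ^ 2 / 4) ^ k / ((k.factorial : ℂ) ^ 2)

/-- The Bessel function of the second kind of order zero (principal branch),
`Y₀(z) = (2/π) (log (z/2) + γ) J₀(z) - (2/π) ∑_{k ≥ 0} (-1)^k H_k (z²/4)^k / (k!)²`,
where `γ` is Euler's constant and `H_k = 1 + 1/2 + ⋯ + 1/k` (so that `H_0 = 0`). -/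
def besselYZero (z : ℂ) : ℂ :=
  (2 / (Real.pi : ℂ)) *
      (Complex.log (z / 2) + (Real.eulerMascheroniConstant : ℂ)) * besselJZero z -
    (2 / (Real.pi : ℂ)) *
      ∑' k : ℕ, (-1 : ℂ) ^ k * (harmonic k : ℂ) * (z ^ 2 / 4) ^ k / ((k.factorial : ℂ) ^ 2)

/-- The Hankel function of the first kind of order zero, `H₀⁽¹⁾ = J₀ + i Y₀`. -/
def hankelOneZero (z : ℂ) : ℂ :=
  besselJZero z + Complex.I * besselYZero z

/-- The integrand `T_n(2x - 1) H₀⁽¹⁾(ωx) e^{iωβx}` of the `n`-th shifted Chebyshev moment. -/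
def momentIntegrand (n : ℕ) (ω β x : ℝ) : ℂ :=
  (((Polynomial.Chebyshev.T ℝ n).eval (2 * x - 1) : ℝ) : ℂ) *
    hankelOneZero ((ω : ℂ) * x) * Complex.exp (Complex.I * ω * β * x)

/-- The `n`-th shifted Chebyshev moment
`σ_n⁽¹⁾ = ∫_0^1 T_n(2x - 1) H₀⁽¹⁾(ωx) e^{iωβx} dx`. -/
def chebyshevMoment (n : ℕ) (ω β : ℝ) : ℂ :=
  ∫ x in (0 : ℝ)..1, momentIntegrand n ω β x

/-- The integrand
`t^{-1/2} (e^{i(β+1)ω} e^{-tω} - 1) / (√(2i - t) (1 + β + it))`, with the principal branch of the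
complex square root, i.e. the one with nonnegative real part. -/
def closedFormIntegrand (ω β t : ℝ) : ℂ :=
  (1 / ((Real.sqrt t : ℝ) : ℂ)) *
    ((Complex.exp (Complex.I * (β + 1) * ω) * Complex.exp (-(t : ℂ) * ω) - 1) /
      ((2 * Complex.I - (t : ℂ)) ^ (1 / 2 : ℂ) * (1 + β + Complex.I * t)))

end

open Real Set Filter Topology MeasureTheory

/-! Everything rests on the Laplace representation H₀⁽¹⁾(x) = (2/π) e^{ix} ∫₀^∞ e^{-xt} / (√t
√(2i-t)) dt for x > 0 (`hankelOneZero_eq_hankelLaplace`). Inserting it at ωx makes the zeroth moment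
an iterated integral over (0,1] × (0,∞). The kernel is absolutely integrable there, and its
x-dependence is a pure exponential, so exchanging the integrals and integrating in x first yields
the closed form. Fubini also gives both convergence claims, including β = -1, where the denominator
vanishes at t = 0.

The representation is proved by uniqueness for Bessel's equation, written as the system F' = P/x, P'
= -xF. The power series satisfies it by coefficient recurrences, the Laplace integral by integrating
a total derivative (`hankelMoment_recurrence`). Both sides behave like 1 + (2i/π)(log(x/2) + γ) at
0, and both fluxes P tend to 2i/π. The difference therefore solves the system with zero limits, and
a monotone energy forces it to vanish (`besselSystem_unique`).

The delicate point is the constant term of the Laplace integral at 0. It comes from an explicit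
primitive of the weight that grows like -i log(4t), together with Γ'(1) = -γ
(`hankelMoment_zero_eq`). -/

/-! ### Uniqueness for the Bessel system with zero limits at the origin. -/

/-- A real solution of the Bessel system `D' = P / x`, `P' = -x D` on `(0, ∞)` with
`D, P → 0` at `0` vanishes. -/
lemma besselSystem_unique_real {D P : ℝ → ℝ}
    (hD : ∀ x, 0 < x → HasDerivAt D (P x / x) x)
    (hP : ∀ x, 0 < x → HasDerivAt P (-(x * D x)) x)
    (hD0 : Tendsto D (𝓝[>] 0) (𝓝 0)) (hP0 : Tendsto P (𝓝[>] 0) (𝓝 0)) {x : ℝ} (hx : 0 < x) :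
    D x = 0 := by
  obtain ⟨δ, hδ, hDδ⟩ : ∃ δ > 0, ∀ y, 0 < y → y < δ → |D y| ≤ 1 := by
    have h := hD0.abs.eventually_le_const (u := 1) (by norm_num)
    obtain ⟨δ, hδ, h⟩ := mem_nhdsGT_iff_exists_Ioo_subset.1 h
    exact ⟨δ, hδ, fun y h0 h1 => h ⟨h0, h1⟩⟩
  -- Near 0, |P'| ≤ z because |D| ≤ 1. The mean value inequality on [ε, y] with ε → 0 gives a
  -- quadratic bound, which upgrades P → 0 to P/y → 0.
  have hPle : ∀ y, 0 < y → y < δ → |P y| ≤ y ^ 2 := by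
    intro y hy hyδ
    have hev : ∀ᶠ ε in 𝓝[>] (0 : ℝ), |P y - P ε| ≤ y ^ 2 := by
      filter_upwards [Ioo_mem_nhdsGT hy] with ε hε
      have h := (convex_Icc ε y).norm_image_sub_le_of_norm_hasDerivWithin_le (f := P)
        (f' := fun z => -(z * D z)) (C := y)
        (fun z hz => (hP z (hε.1.trans_le hz.1)).hasDerivWithinAt)
        (fun z hz => by
          have hz0 := hε.1.trans_le hz.1
          rw [norm_neg, norm_mul, norm_of_nonneg hz0.le]
          calc z * ‖D z‖ ≤ y * 1 := by
                gcongr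
                · exact hz.2
                · exact hDδ z hz0 (hz.2.trans_lt hyδ)
            _ = y := mul_one y)
        (left_mem_Icc.2 hε.2.le) (right_mem_Icc.2 hε.2.le)
      rw [norm_eq_abs, norm_of_nonneg (by linarith [hε.2])] at h
      nlinarith [hε.1]
    have hlim : Tendsto (fun ε => |P y - P ε|) (𝓝[>] 0) (𝓝 |P y - 0|) :=
      (tendsto_const_nhds.sub hP0).abs
    simpa using le_of_tendsto hlim hev
  have hPx : Tendsto (fun y => P y / y) (𝓝[>] 0) (𝓝 0) := by
    refine squeeze_zero_norm' (a := fun y => y) ?_ (tendsto_id.mono_left nhdsWithin_le_nhds)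
    filter_upwards [Ioo_mem_nhdsGT hδ] with y hy
    rw [norm_div, norm_of_nonneg hy.1.le, div_le_iff₀ hy.1, norm_eq_abs, ← sq]
    exact hPle y hy.1 hy.2
  -- The oscillator energy D² + D'²: the cross terms cancel in its derivative and only the damping
  -- -2P²/y³ ≤ 0 remains. A nonnegative nonincreasing function with limit 0 at 0 is zero.
  set E : ℝ → ℝ := fun y => D y ^ 2 + (P y / y) ^ 2
  have hE0 : Tendsto E (𝓝[>] 0) (𝓝 0) := by
    simpa using (hD0.pow 2).add (hPx.pow 2)
  have hE : ∀ y, 0 < y → HasDerivAt E (-(2 * P y ^ 2 / y ^ 3)) y := by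
    intro y hy
    have h := ((hD y hy).pow 2).add ((((hP y hy).div (hasDerivAt_id y) hy.ne')).pow 2)
    refine h.congr_deriv ?_
    have hy0 := hy.ne'
    simp only [id, Pi.div_apply, Nat.cast_ofNat, Nat.add_one_sub_one, pow_one, mul_one]
    field_simp
    ring
  have hanti : AntitoneOn E (Ioi 0) := by
    refine antitoneOn_of_deriv_nonpos (convex_Ioi 0)
      (fun y hy => (hE y hy).continuousAt.continuousWithinAt) ?_ ?_
    · rw [interior_Ioi]
      exact fun y hy => (hE y hy).differentiableAt.differentiableWithinAt
    · rw [interior_Ioi]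
      intro y hy
      have hy' : 0 < y := hy
      rw [(hE y hy).deriv, neg_nonpos]
      positivity
  have hEx : E x ≤ 0 := by
    refine ge_of_tendsto hE0 ?_
    filter_upwards [Ioo_mem_nhdsGT hx] with ε hε
    exact hanti hε.1 hx hε.2.le
  have : D x ^ 2 ≤ 0 := by
    have : 0 ≤ (P x / x) ^ 2 := sq_nonneg _
    simp only [E] at hEx
    linarith
  exact pow_eq_zero_iff two_ne_zero |>.1 (le_antisymm this (sq_nonneg _))

/-- A complex solution of the Bessel system `D' = P / x`, `P' = -x D` on `(0, ∞)` with
`D, P → 0` at `0` vanishes. -/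
lemma besselSystem_unique {D P : ℝ → ℂ}
    (hD : ∀ x, 0 < x → HasDerivAt D (P x / x) x)
    (hP : ∀ x, 0 < x → HasDerivAt P (-(x * D x)) x)
    (hD0 : Tendsto D (𝓝[>] 0) (𝓝 0)) (hP0 : Tendsto P (𝓝[>] 0) (𝓝 0)) {x : ℝ} (hx : 0 < x) :
    D x = 0 := by
  -- The system has real coefficients, so real and imaginary parts solve it separately.
  have key : ∀ L : ℂ →L[ℝ] ℝ, L (D x) = 0 := by
    intro L
    refine besselSystem_unique_real (D := fun y => L (D y)) (P := fun y => L (P y)) ?_ ?_ ?_ ?_ hx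
    · intro y hy
      have h := L.hasFDerivAt.comp_hasDerivAt y (hD y hy)
      refine h.congr_deriv ?_
      rw [show P y / (y : ℂ) = (y⁻¹ : ℝ) • P y by
        rw [Complex.real_smul, Complex.ofReal_inv, div_eq_inv_mul], map_smul, smul_eq_mul,
        div_eq_inv_mul]
    · intro y hy
      have h := L.hasFDerivAt.comp_hasDerivAt y (hP y hy)
      refine h.congr_deriv ?_
      rw [← Complex.real_smul, map_neg, map_smul, smul_eq_mul]
    · simpa [Function.comp_def] using (L.continuous.tendsto 0).comp hD0
    · simpa [Function.comp_def] using (L.continuous.tendsto 0).comp hP0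
  exact Complex.ext (key Complex.reCLM) (key Complex.imCLM)

/-! ### The square root, the weight and its primitive. -/

/-- The square root `√(2i - t)`. -/
noncomputable def hankelRoot (t : ℝ) : ℂ := (2 * Complex.I - (t : ℂ)) ^ (1 / 2 : ℂ)

lemma two_I_sub_mem_slitPlane (t : ℝ) : 2 * Complex.I - (t : ℂ) ∈ Complex.slitPlane := by
  right
  simp

lemma hankelRoot_sq (t : ℝ) : hankelRoot t ^ 2 = 2 * Complex.I - (t : ℂ) := by
  rw [hankelRoot, ← Complex.cpow_nat_mul]
  norm_num

lemma hankelRoot_re_nonneg (t : ℝ) : 0 ≤ (hankelRoot t).re := by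
  have h0 : 2 * Complex.I - (t : ℂ) ≠ 0 := Complex.slitPlane_ne_zero (two_I_sub_mem_slitPlane t)
  rw [hankelRoot, Complex.cpow_def_of_ne_zero h0, Complex.exp_re]
  refine mul_nonneg (exp_pos _).le (cos_nonneg_of_mem_Icc ?_)
  have him : (Complex.log (2 * Complex.I - (t : ℂ)) * (1 / 2)).im
      = (2 * Complex.I - (t : ℂ)).arg / 2 := by
    rw [show (1 / 2 : ℂ) = ((1 / 2 : ℝ) : ℂ) by norm_num, Complex.im_mul_ofReal, Complex.log_im]
    ring
  rw [him]
  have h1 := Complex.neg_pi_lt_arg (2 * Complex.I - (t : ℂ))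
  have h2 := Complex.arg_le_pi (2 * Complex.I - (t : ℂ))
  constructor <;> linarith

/-- Real and imaginary parts of r² = 2i - t. With Re r ≥ 0 they force Im r > 0 and (Im r)² ≥ t,
which keeps √t - i r in the right half-plane. -/
lemma hankelRoot_components (t : ℝ) :
    (hankelRoot t).re ^ 2 - (hankelRoot t).im ^ 2 = -t ∧
      (hankelRoot t).re * (hankelRoot t).im = 1 := by
  have h := hankelRoot_sq t
  rw [sq] at h
  have h1 := congrArg Complex.re h
  have h2 := congrArg Complex.im h
  simp at h1 h2
  constructor <;> linarith

lemma hankelRoot_im_pos (t : ℝ) : 0 < (hankelRoot t).im := by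
  have h := (hankelRoot_components t).2
  exact pos_of_mul_pos_right (h ▸ one_pos) (hankelRoot_re_nonneg t)

lemma sqrt_le_hankelRoot_im (t : ℝ) : √t ≤ (hankelRoot t).im := by
  rw [sqrt_le_left (hankelRoot_im_pos t).le]
  nlinarith [(hankelRoot_components t).1, sq_nonneg (hankelRoot t).re]

lemma hankelRoot_ne_zero (t : ℝ) : hankelRoot t ≠ 0 := fun h => by
  have := hankelRoot_im_pos t
  simp [h] at this

lemma one_le_norm_hankelRoot (t : ℝ) : 1 ≤ ‖hankelRoot t‖ := by
  have h1 : ‖hankelRoot t‖ ^ 2 = ‖2 * Complex.I - (t : ℂ)‖ := by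
    rw [← norm_pow, hankelRoot_sq]
  have h2 := Complex.abs_im_le_norm (2 * Complex.I - (t : ℂ))
  simp at h2
  nlinarith [norm_nonneg (hankelRoot t)]

lemma norm_hankelRoot_le {t : ℝ} (ht : 0 < t) : ‖hankelRoot t‖ ≤ t + 2 := by
  have h1 : ‖hankelRoot t‖ ^ 2 = ‖2 * Complex.I - (t : ℂ)‖ := by
    rw [← norm_pow, hankelRoot_sq]
  have h2 : ‖2 * Complex.I - (t : ℂ)‖ ≤ 2 + t := by
    refine (norm_sub_le _ _).trans ?_
    simp [abs_of_pos ht]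
  nlinarith [one_le_norm_hankelRoot t]

lemma hasDerivAt_hankelRoot (t : ℝ) : HasDerivAt hankelRoot (-1 / (2 * hankelRoot t)) t := by
  have h1 : HasDerivAt (fun z : ℂ => 2 * Complex.I - z) (-1) (t : ℂ) :=
    (hasDerivAt_id (t : ℂ)).const_sub _
  have h := (h1.cpow_const (c := (1 / 2 : ℂ)) (two_I_sub_mem_slitPlane t)).comp_ofReal
  refine h.congr_deriv ?_
  have h0 := hankelRoot_ne_zero t
  have hne : 2 * Complex.I - (t : ℂ) ≠ 0 := Complex.slitPlane_ne_zero (two_I_sub_mem_slitPlane t)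
  rw [Complex.cpow_sub _ _ hne, Complex.cpow_one, ← hankelRoot_sq t]
  have : (hankelRoot t ^ 2) ^ (1 / 2 : ℂ) = hankelRoot t := by rw [hankelRoot_sq]; rfl
  rw [this]
  field_simp

lemma continuous_hankelRoot : Continuous hankelRoot :=
  continuous_iff_continuousAt.2 fun t => (hasDerivAt_hankelRoot t).continuousAt

lemma hankelRoot_zero : hankelRoot 0 = 1 + Complex.I := by
  have h1 := (hankelRoot_components 0).1
  have h2 := (hankelRoot_components 0).2
  have h3 := hankelRoot_im_pos 0
  have h4 := hankelRoot_re_nonneg 0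
  have h5 : (hankelRoot 0).re = (hankelRoot 0).im := by
    rw [neg_zero, sub_eq_zero] at h1
    exact (pow_left_inj₀ h4 h3.le two_ne_zero).1 h1
  have h6 : (hankelRoot 0).im = 1 := by
    rw [h5] at h2
    nlinarith
  apply Complex.ext <;> simp [h5, h6]

/-- The weight `1 / (√t √(2i - t))`. -/
noncomputable def hankelWeight (t : ℝ) : ℂ := 1 / (((√t : ℝ) : ℂ) * hankelRoot t)

lemma norm_hankelWeight_le {t : ℝ} (ht : 0 < t) : ‖hankelWeight t‖ ≤ t ^ (-1 / 2 : ℝ) := by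
  have h := one_le_norm_hankelRoot t
  have hs : 0 < √t := sqrt_pos.2 ht
  rw [hankelWeight, norm_div, norm_mul, norm_one, Complex.norm_real, norm_of_nonneg hs.le,
    show (-1 / 2 : ℝ) = -(1 / 2) by norm_num, rpow_neg ht.le, ← sqrt_eq_rpow, one_div]
  gcongr
  nlinarith

lemma measurable_hankelWeight : Measurable hankelWeight := by
  have := continuous_hankelRoot
  unfold hankelWeight
  fun_prop

/-- The sum `√t - i √(2i - t)`, whose real part is at least `2√t`. -/
lemma sqrt_sub_I_mul_hankelRoot_re (t : ℝ) :
    2 * √t ≤ (((√t : ℝ) : ℂ) - Complex.I * hankelRoot t).re ∧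
    0 < (((√t : ℝ) : ℂ) - Complex.I * hankelRoot t).re := by
  have h1 := sqrt_le_hankelRoot_im t
  have h2 := hankelRoot_im_pos t
  have h3 := sqrt_nonneg t
  simp
  constructor <;> linarith

/-- An antiderivative of `hankelWeight`. -/
noncomputable def hankelPrimitive (t : ℝ) : ℂ :=
  -2 * Complex.I * Complex.log (((√t : ℝ) : ℂ) - Complex.I * hankelRoot t)

lemma continuous_hankelPrimitive : Continuous hankelPrimitive := by
  have := continuous_hankelRoot
  unfold hankelPrimitive
  refine continuous_const.mul (Continuous.clog (by fun_prop) fun t => ?_)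
  exact Or.inl (sqrt_sub_I_mul_hankelRoot_re t).2

/-- With s = √t, r = √(2i-t) and a = s - i r, one finds a' = i a / (2 s r), so the logarithmic
derivative of a is i/(2 s r). -/
lemma hasDerivAt_hankelPrimitive {t : ℝ} (ht : 0 < t) :
    HasDerivAt hankelPrimitive (hankelWeight t) t := by
  have hs := (hasDerivAt_sqrt ht.ne').ofReal_comp
  have h := ((hs.sub ((hasDerivAt_hankelRoot t).const_mul Complex.I)).clog_real
    (Or.inl (sqrt_sub_I_mul_hankelRoot_re t).2)).const_mul (-2 * Complex.I)
  refine h.congr_deriv ?_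
  have h0 := hankelRoot_ne_zero t
  have h1 : ((√t : ℝ) : ℂ) ≠ 0 := Complex.ofReal_ne_zero.2 (sqrt_pos.2 ht).ne'
  have h2 : ((√t : ℝ) : ℂ) - Complex.I * hankelRoot t ≠ 0 := fun h => by
    have := (sqrt_sub_I_mul_hankelRoot_re t).2
    simp [h] at this
  simp only [hankelWeight, Pi.sub_apply]
  push_cast
  field_simp
  linear_combination (-((√t : ℝ) : ℂ)) * Complex.I_sq

/-- At t = 0 the argument of the logarithm is -i(1 + i) = 1 - i = √2 e^{-iπ/4}. The π/2 becomes the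
constant 1 in the leading behaviour of H₀⁽¹⁾. -/
lemma hankelPrimitive_zero :
    hankelPrimitive 0 = -Complex.I * (Real.log 2 : ℂ) - (π : ℂ) / 2 := by
  have h : (1 : ℂ) - Complex.I = ((√2 : ℝ) : ℂ) * Complex.exp ((-(π / 4) : ℝ) * Complex.I) := by
    have h2 : √2 * √2 = 2 := mul_self_sqrt (by norm_num)
    rw [Complex.exp_mul_I, ← Complex.ofReal_cos, ← Complex.ofReal_sin, cos_neg, sin_neg,
      cos_pi_div_four, sin_pi_div_four]
    apply Complex.ext <;> simp <;> linarith
  rw [hankelPrimitive, hankelRoot_zero, sqrt_zero,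
    show ((0 : ℝ) : ℂ) - Complex.I * (1 + Complex.I) = 1 - Complex.I by
      push_cast; linear_combination -Complex.I_sq, h,
    Complex.log_ofReal_mul (by positivity) (Complex.exp_ne_zero _), Complex.log_exp
      (by simp; linarith [pi_pos]) (by simp; linarith [pi_pos]), log_sqrt (by norm_num)]
  push_cast
  linear_combination (-(π : ℂ) / 2 * (-1)) * Complex.I_sq

/-- Mean value inequality on the convex half-plane Re ≥ 1, where |1/w| ≤ 1. -/
lemma norm_log_le_norm_sub_one {z : ℂ} (hz : 1 ≤ z.re) : ‖Complex.log z‖ ≤ ‖z - 1‖ := by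
  have h := (convex_halfSpace_re_ge (1 : ℝ)).norm_image_sub_le_of_norm_hasDerivWithin_le
    (𝕜 := ℂ) (f := Complex.log) (f' := fun z => z⁻¹) (C := 1) (x := 1) (y := z)
    (fun w hw => (Complex.hasDerivAt_log (Or.inl (one_pos.trans_le hw))).hasDerivWithinAt)
    (fun w hw => by
      rw [norm_inv]
      exact inv_le_one_of_one_le₀ (le_trans hw (Complex.re_le_norm w)))
    (mem_ofPred.2 Complex.one_re.ge) hz
  simpa using h

/-- Dividing √t - i√(2i-t) by its large-t size 2√t leaves q with Re q ≥ 1, and the left side is -2i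
log q. It remains to see that q - 1 is O(t^{-1/2}). -/
lemma norm_hankelPrimitive_add_log_le {t : ℝ} (ht : 0 < t) :
    ‖hankelPrimitive t + Complex.I * (Real.log (4 * t) : ℂ)‖ ≤ 2 * t ^ (-1 / 2 : ℝ) := by
  have hs : 0 < √t := sqrt_pos.2 ht
  have hsC : ((√t : ℝ) : ℂ) ≠ 0 := Complex.ofReal_ne_zero.2 hs.ne'
  set a : ℂ := ((√t : ℝ) : ℂ) - Complex.I * hankelRoot t with ha
  set q : ℂ := a / ((2 * √t : ℝ) : ℂ) with hq
  have hqa : a = ((2 * √t : ℝ) : ℂ) * q := by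
    rw [hq]; push_cast; field_simp
  have hqre : 1 ≤ q.re := by
    rw [hq, Complex.div_ofReal_re, le_div_iff₀ (by positivity), one_mul]
    exact (sqrt_sub_I_mul_hankelRoot_re t).1
  have hq0 : q ≠ 0 := fun h => by simp [h] at hqre; linarith
  have hlog : Complex.log a = (Real.log (4 * t) : ℂ) / 2 + Complex.log q := by
    rw [hqa, Complex.log_ofReal_mul (by positivity) hq0,
      show 4 * t = (2 * √t) ^ 2 by rw [mul_pow, sq_sqrt ht.le]; norm_num, log_pow]
    push_cast
    ring
  have hV : hankelPrimitive t + Complex.I * (Real.log (4 * t) : ℂ)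
      = -2 * Complex.I * Complex.log q := by
    rw [hankelPrimitive, ← ha, hlog]
    ring
  have hsq : ((√t : ℝ) : ℂ) ^ 2 = (t : ℂ) := by
    rw [← Complex.ofReal_pow, sq_sqrt ht.le]
  -- This is (a - 2√t) a = -(t + (2i - t)), in which t cancels. Since |q - 1| ≤ |q|, it bounds |q -
  -- 1|² by 1/(2t).
  have hprod : (q - 1) * q * ((2 * √t : ℝ) : ℂ) ^ 2 = -2 * Complex.I := by
    have : (q - 1) * q * ((2 * √t : ℝ) : ℂ) ^ 2 = (((2 * √t : ℝ) : ℂ) * q - ((2 * √t : ℝ) : ℂ))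
      * (((2 * √t : ℝ) : ℂ) * q) := by ring
    rw [this, ← hqa, ha]
    push_cast
    linear_combination (-1 : ℂ) * hsq + Complex.I ^ 2 * hankelRoot_sq t
      + (2 * Complex.I - t) * Complex.I_sq
  have hle : ‖q - 1‖ ≤ ‖q‖ := by
    rw [← sq_le_sq₀ (norm_nonneg _) (norm_nonneg _), ← Complex.normSq_eq_norm_sq,
      ← Complex.normSq_eq_norm_sq, Complex.normSq_apply, Complex.normSq_apply]
    simp
    nlinarith
  have hn : ‖q - 1‖ ^ 2 * (4 * t) ≤ 2 := by
    have h := congrArg norm hprod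
    rw [norm_mul, norm_mul, norm_pow, Complex.norm_real, norm_of_nonneg (by positivity), mul_pow,
      sq_sqrt ht.le] at h
    norm_num at h
    nlinarith [norm_nonneg (q - 1), mul_le_mul_of_nonneg_left hle (norm_nonneg (q - 1))]
  have hfin : ‖q - 1‖ * √t ≤ 1 := by
    rw [← sq_le_sq₀ (by positivity) (by positivity), mul_pow, sq_sqrt ht.le]
    nlinarith
  rw [hV, norm_mul, norm_mul, norm_neg, Complex.norm_I, Complex.norm_ofNat, mul_one,
    show (-1 / 2 : ℝ) = -(1 / 2) by norm_num, rpow_neg ht.le, ← sqrt_eq_rpow]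
  gcongr
  refine (norm_log_le_norm_sub_one hqre).trans ?_
  rwa [inv_eq_one_div, le_div_iff₀ hs]

/-- The left side is (√t + i r)/r with r = √(2i-t). Multiplying by the conjugate factor a = √t - i r
turns the numerator into t + r² = 2i. -/
lemma norm_hankelWeight_add_le {t : ℝ} (ht : 0 < t) :
    ‖(t : ℂ) * hankelWeight t + Complex.I‖ ≤ 2 * t ^ (-1 / 2 : ℝ) := by
  have hs : 0 < √t := sqrt_pos.2 ht
  have hsC : ((√t : ℝ) : ℂ) ≠ 0 := Complex.ofReal_ne_zero.2 hs.ne'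
  have h0 := hankelRoot_ne_zero t
  have hsq : ((√t : ℝ) : ℂ) ^ 2 = (t : ℂ) := by
    rw [← Complex.ofReal_pow, sq_sqrt ht.le]
  have hb := (sqrt_sub_I_mul_hankelRoot_re t)
  set a : ℂ := ((√t : ℝ) : ℂ) - Complex.I * hankelRoot t with ha
  have ha0 : a ≠ 0 := fun h => by
    have := hb.2
    simp [h] at this
  have hanorm : √t ≤ ‖a‖ := by
    have := Complex.re_le_norm a
    linarith
  have key : (t : ℂ) * hankelWeight t + Complex.I = 2 * Complex.I / (hankelRoot t * a) := by
    rw [hankelWeight, eq_div_iff (mul_ne_zero h0 ha0), ← hsq]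
    field_simp
    rw [ha]
    linear_combination hsq + hankelRoot_sq t - hankelRoot t ^ 2 * Complex.I_sq
  rw [key, norm_div, norm_mul, norm_mul, Complex.norm_I, Complex.norm_ofNat, mul_one,
    show (-1 / 2 : ℝ) = -(1 / 2) by norm_num, rpow_neg ht.le, ← sqrt_eq_rpow, ← div_eq_mul_inv]
  gcongr
  nlinarith [one_le_norm_hankelRoot t, norm_nonneg a]

/-! ### Laplace transforms of t^{-1/2}-bounded functions and of the logarithm. -/

lemma integrableOn_rpow_mul_exp_neg_mul {a x : ℝ} (ha : -1 < a) (hx : 0 < x) :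
    IntegrableOn (fun t : ℝ => t ^ a * exp (-(x * t))) (Ioi 0) := by
  simpa using integrableOn_rpow_mul_exp_neg_mul_rpow ha one_pos hx

lemma integrableOn_laplace_of_norm_le {f : ℝ → ℂ} (hf : AEStronglyMeasurable f (volume.restrict (Ioi 0)))
    {C : ℝ} (hC : ∀ t, 0 < t → ‖f t‖ ≤ C * t ^ (-1 / 2 : ℝ)) (k : ℕ) {x : ℝ} (hx : 0 < x) :
    IntegrableOn (fun t : ℝ => ((t ^ k * exp (-(x * t)) : ℝ) : ℂ) * f t) (Ioi 0) := by
  have hk : (-1 : ℝ) < k + (-1 / 2 : ℝ) := by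
    have : (0 : ℝ) ≤ k := k.cast_nonneg
    linarith
  refine ((integrableOn_rpow_mul_exp_neg_mul hk hx).const_mul C).mono' ?_ ?_
  · exact (Continuous.aestronglyMeasurable (by fun_prop)).mul hf
  · filter_upwards [ae_restrict_mem measurableSet_Ioi] with t ht
    have ht : 0 < t := ht
    rw [norm_mul, Complex.norm_real, norm_of_nonneg (by positivity), rpow_add ht, rpow_natCast]
    calc t ^ k * exp (-(x * t)) * ‖f t‖ ≤ t ^ k * exp (-(x * t)) * (C * t ^ (-1 / 2 : ℝ)) := by
          gcongr
          exact hC t ht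
      _ = _ := by ring

/-- The transform is at most C Γ(1/2) x^{-1/2}, so x times it is O(√x). This disposes of every
remainder at the origin. -/
lemma tendsto_mul_laplace_zero {f : ℝ → ℂ} {C : ℝ}
    (hC : ∀ t, 0 < t → ‖f t‖ ≤ C * t ^ (-1 / 2 : ℝ)) :
    Tendsto (fun x : ℝ => (x : ℂ) * ∫ t in Ioi (0 : ℝ), ((exp (-(x * t)) : ℝ) : ℂ) * f t)
      (𝓝[>] 0) (𝓝 0) := by
  refine squeeze_zero_norm' (a := fun x => C * Gamma (1 / 2) * √x) ?_ ?_
  · filter_upwards [self_mem_nhdsWithin] with x hx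
    have hx : 0 < x := hx
    have h : ‖∫ t in Ioi (0 : ℝ), ((exp (-(x * t)) : ℝ) : ℂ) * f t‖
        ≤ ∫ t in Ioi (0 : ℝ), C * (t ^ ((1 / 2 : ℝ) - 1) * exp (-(x * t))) := by
      refine norm_integral_le_of_norm_le
        ((integrableOn_rpow_mul_exp_neg_mul (by norm_num) hx).const_mul C) ?_
      filter_upwards [ae_restrict_mem measurableSet_Ioi] with t ht
      rw [norm_mul, Complex.norm_real, norm_of_nonneg (by positivity),
        show (1 / 2 : ℝ) - 1 = -1 / 2 by norm_num]
      calc exp (-(x * t)) * ‖f t‖ ≤ exp (-(x * t)) * (C * t ^ (-1 / 2 : ℝ)) := by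
            gcongr
            exact hC t ht
        _ = _ := by ring
    rw [integral_const_mul, integral_rpow_mul_exp_neg_mul_Ioi (by norm_num) hx, ← sqrt_eq_rpow] at h
    rw [norm_mul, Complex.norm_real, norm_of_nonneg hx.le]
    calc _ ≤ x * (C * (√(1 / x) * Gamma (1 / 2))) := by gcongr
      _ = C * Gamma (1 / 2) * (x / √x) := by
        rw [one_div, sqrt_inv]; ring
      _ = _ := by rw [div_sqrt]
  · have h : Tendsto (fun x => C * Gamma (1 / 2) * √x) (𝓝 0) (𝓝 (C * Gamma (1 / 2) * √0)) :=
      (continuous_const.mul continuous_sqrt).tendsto 0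
    simp only [sqrt_zero, mul_zero] at h
    exact h.mono_left nhdsWithin_le_nhds

lemma abs_log_le_add_rpow {t : ℝ} (ht : 0 < t) : |log t| ≤ t + 2 * t ^ (-1 / 2 : ℝ) := by
  have h1 : log t ≤ t := (log_le_sub_one_of_pos ht).trans (by linarith)
  -- Applying log u ≤ u - 1 to u = t^{-1/2} controls -log t near 0 by an integrable power.
  have h2 := log_le_sub_one_of_pos (rpow_pos_of_pos ht (-1 / 2 : ℝ))
  rw [log_rpow ht] at h2
  have h3 := rpow_pos_of_pos ht (-1 / 2 : ℝ)
  rw [abs_le]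
  constructor <;> linarith

lemma integrableOn_exp_neg_mul {x : ℝ} (hx : 0 < x) :
    IntegrableOn (fun t : ℝ => exp (-(x * t))) (Ioi 0) := by
  simpa using integrableOn_rpow_mul_exp_neg_mul (a := 0) (by norm_num) hx

lemma integral_exp_neg_mul {x : ℝ} (hx : 0 < x) :
    ∫ t in Ioi (0 : ℝ), exp (-(x * t)) = x⁻¹ := by
  have h := integral_exp_mul_Ioi (neg_neg_of_pos hx) 0
  simp only [neg_mul, mul_zero, exp_zero, neg_div_neg_eq] at h
  rw [h, one_div]

lemma integrableOn_exp_neg_mul_log {x : ℝ} (hx : 0 < x) :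
    IntegrableOn (fun t : ℝ => exp (-(x * t)) * log t) (Ioi 0) := by
  have h1 := integrableOn_rpow_mul_exp_neg_mul (a := 1) (by norm_num) hx
  have h2 := (integrableOn_rpow_mul_exp_neg_mul (a := -1 / 2) (by norm_num) hx).const_mul 2
  refine (h1.add h2).mono' (Measurable.aestronglyMeasurable (by fun_prop)) ?_
  filter_upwards [ae_restrict_mem measurableSet_Ioi] with t ht
  have h := abs_log_le_add_rpow ht
  simp only [Pi.add_apply, rpow_one]
  rw [norm_mul, norm_of_nonneg (exp_pos _).le, norm_eq_abs]
  nlinarith [exp_pos (-(x * t))]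

/-- Both sides are Γ'(1), the left one by differentiating Euler's integral. This is where Euler's
constant enters on the Laplace side. -/
lemma integral_exp_neg_log :
    ∫ t in Ioi (0 : ℝ), exp (-t) * log t = -eulerMascheroniConstant := by
  have h1 := Complex.hasDerivAt_GammaIntegral (s := 1) (by simp)
  have h2 : Complex.Gamma =ᶠ[𝓝 1] Complex.GammaIntegral := by
    have : {s : ℂ | 0 < s.re} ∈ 𝓝 (1 : ℂ) :=
      (isOpen_lt continuous_const Complex.continuous_re).mem_nhds (by simp)
    filter_upwards [this] with s hs using Complex.Gamma_eq_integral hs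
  have h3 := (h1.congr_of_eventuallyEq h2).unique Complex.hasDerivAt_Gamma_one
  simp only [sub_self, Complex.cpow_zero, one_mul] at h3
  have h4 : ∫ t in Ioi (0 : ℝ), ((exp (-t) * log t : ℝ) : ℂ)
      = ((-eulerMascheroniConstant : ℝ) : ℂ) := by
    rw [Complex.ofReal_neg, ← h3]
    congr 1
    ext t
    push_cast
    ring
  rw [integral_complex_ofReal] at h4
  exact_mod_cast h4

lemma integral_exp_neg_mul_log {x : ℝ} (hx : 0 < x) :
    ∫ t in Ioi (0 : ℝ), exp (-(x * t)) * log t = -(eulerMascheroniConstant + log x) / x := by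
  have h1 := integral_comp_mul_left_Ioi (fun u => exp (-u) * log u) 0 hx
  rw [mul_zero, integral_exp_neg_log, smul_eq_mul] at h1
  have h2 : ∫ t in Ioi (0 : ℝ), exp (-(x * t)) * log (x * t)
      = ∫ t in Ioi (0 : ℝ), (log x * exp (-(x * t)) + exp (-(x * t)) * log t) := by
    refine setIntegral_congr_fun measurableSet_Ioi fun t ht => ?_
    rw [log_mul hx.ne' (ne_of_gt ht)]
    ring
  rw [h2, integral_add ((integrableOn_exp_neg_mul hx).const_mul _)
    (integrableOn_exp_neg_mul_log hx), integral_const_mul, integral_exp_neg_mul hx] at h1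
  field_simp at h1 ⊢
  linarith

/-! ### Moments of the weight: derivatives, limits at the origin, recurrence. -/

/-- The moments `∫₀^∞ t^k e^{-xt} / (√t √(2i - t)) dt`. -/
noncomputable def hankelMoment (k : ℕ) (x : ℝ) : ℂ :=
  ∫ t in Ioi (0 : ℝ), ((t ^ k * exp (-(x * t)) : ℝ) : ℂ) * hankelWeight t

lemma norm_hankelWeight_le' {t : ℝ} (ht : 0 < t) : ‖hankelWeight t‖ ≤ 1 * t ^ (-1 / 2 : ℝ) := by
  rw [one_mul]
  exact norm_hankelWeight_le ht

lemma integrableOn_hankelMoment (k : ℕ) {x : ℝ} (hx : 0 < x) :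
    IntegrableOn (fun t : ℝ => ((t ^ k * exp (-(x * t)) : ℝ) : ℂ) * hankelWeight t) (Ioi 0) :=
  integrableOn_laplace_of_norm_le measurable_hankelWeight.aestronglyMeasurable
    (fun _ => norm_hankelWeight_le') k hx

lemma hasDerivAt_hankelMoment (k : ℕ) {x : ℝ} (hx : 0 < x) :
    HasDerivAt (hankelMoment k) (-hankelMoment (k + 1) x) x := by
  -- On y > x/2 the differentiated integrands are dominated by the one at x/2.
  have hs : Ioi (x / 2) ∈ 𝓝 x := Ioi_mem_nhds (by linarith)
  have h := (hasDerivAt_integral_of_dominated_loc_of_deriv_le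
    (μ := volume.restrict (Ioi (0 : ℝ)))
    (F := fun y t => ((t ^ k * exp (-(y * t)) : ℝ) : ℂ) * hankelWeight t)
    (F' := fun y t => -(((t ^ (k + 1) * exp (-(y * t)) : ℝ) : ℂ) * hankelWeight t))
    (bound := fun t => ‖((t ^ (k + 1) * exp (-(x / 2 * t)) : ℝ) : ℂ) * hankelWeight t‖)
    (x₀ := x) hs ?_ (integrableOn_hankelMoment k hx)
    (integrableOn_hankelMoment (k + 1) hx).neg.aestronglyMeasurable ?_
    (integrableOn_hankelMoment (k + 1) (half_pos hx)).norm ?_).2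
  · rw [integral_neg] at h
    exact h
  · exact Eventually.of_forall fun y => (Continuous.aestronglyMeasurable (by fun_prop)).mul
      measurable_hankelWeight.aestronglyMeasurable
  · filter_upwards [ae_restrict_mem measurableSet_Ioi] with t ht y hy
    have ht : 0 < t := ht
    rw [norm_neg, norm_mul, norm_mul, Complex.norm_real, Complex.norm_real,
      norm_of_nonneg (by positivity), norm_of_nonneg (by positivity)]
    have : x / 2 ≤ y := le_of_lt hy
    gcongr
  · refine Eventually.of_forall fun t y _ => ?_
    have h1 : HasDerivAt (fun y : ℝ => t ^ k * exp (-(y * t)))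
        (t ^ k * (exp (-(y * t)) * -(1 * t))) y :=
      (((hasDerivAt_id y).mul_const t).neg.exp).const_mul _
    refine (h1.ofReal_comp.mul_const (hankelWeight t)).congr_deriv ?_
    push_cast
    ring

lemma tendsto_id_mul_hankelMoment_zero :
    Tendsto (fun x : ℝ => (x : ℂ) * hankelMoment 0 x) (𝓝[>] 0) (𝓝 0) := by
  simpa [hankelMoment] using tendsto_mul_laplace_zero (fun _ => norm_hankelWeight_le')

/-- Since t times the weight is -i + O(t^{-1/2}), the moment is -i/x plus a remainder negligible
after multiplication by x. -/
lemma tendsto_id_mul_hankelMoment_one :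
    Tendsto (fun x : ℝ => (x : ℂ) * hankelMoment 1 x) (𝓝[>] 0) (𝓝 (-Complex.I)) := by
  have h := (tendsto_mul_laplace_zero (fun _ => norm_hankelWeight_add_le)).sub_const Complex.I
  rw [zero_sub] at h
  refine h.congr' ?_
  filter_upwards [self_mem_nhdsWithin] with x hx
  have hx : 0 < x := hx
  have hi : IntegrableOn (fun t : ℝ => ((exp (-(x * t)) : ℝ) : ℂ) * Complex.I) (Ioi 0) :=
    (integrableOn_exp_neg_mul hx).ofReal.mul_const _
  have h1 : ∫ t in Ioi (0 : ℝ), ((exp (-(x * t)) : ℝ) : ℂ) * ((t : ℂ) * hankelWeight t + Complex.I)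
      = hankelMoment 1 x + (x⁻¹ : ℝ) * Complex.I := by
    rw [← integral_exp_neg_mul hx, ← integral_complex_ofReal, ← integral_mul_const, hankelMoment,
      ← integral_add (integrableOn_hankelMoment 1 hx) hi]
    congr 1
    ext t
    push_cast
    ring
  have hxC : (x : ℂ) ≠ 0 := Complex.ofReal_ne_zero.2 hx.ne'
  rw [h1]
  push_cast
  field_simp
  ring

/-- The remainder of `hankelPrimitive` after its logarithmic growth is removed. -/
noncomputable def hankelRemainder (t : ℝ) : ℂ :=
  hankelPrimitive t + Complex.I * (log (4 * t) : ℂ)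

lemma integrableOn_exp_mul_hankelRemainder {x : ℝ} (hx : 0 < x) :
    IntegrableOn (fun t : ℝ => ((exp (-(x * t)) : ℝ) : ℂ) * hankelRemainder t) (Ioi 0) := by
  have hm : Measurable hankelRemainder := by
    have := continuous_hankelPrimitive.measurable
    unfold hankelRemainder
    fun_prop
  simpa using integrableOn_laplace_of_norm_le hm.aestronglyMeasurable
    (fun _ => norm_hankelPrimitive_add_log_le) 0 hx

lemma integrableOn_exp_mul_log_four {x : ℝ} (hx : 0 < x) :
    IntegrableOn (fun t : ℝ => exp (-(x * t)) * log (4 * t)) (Ioi 0) := by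
  refine IntegrableOn.congr_fun (((integrableOn_exp_neg_mul hx).const_mul (log 4)).add
    (integrableOn_exp_neg_mul_log hx)) (fun t ht => ?_) measurableSet_Ioi
  simp only [Pi.add_apply]
  rw [log_mul (by norm_num) (ne_of_gt ht)]
  ring

lemma integrableOn_ofReal_exp_mul_log_four {x : ℝ} (hx : 0 < x) :
    IntegrableOn (fun t : ℝ => ((exp (-(x * t)) * log (4 * t) : ℝ) : ℂ) * Complex.I) (Ioi 0) :=
  (integrableOn_exp_mul_log_four hx).ofReal.mul_const _

lemma integral_exp_mul_log_four {x : ℝ} (hx : 0 < x) :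
    ∫ t in Ioi (0 : ℝ), exp (-(x * t)) * log (4 * t)
      = (log 4 - eulerMascheroniConstant - log x) / x := by
  have h : ∫ t in Ioi (0 : ℝ), exp (-(x * t)) * log (4 * t)
      = ∫ t in Ioi (0 : ℝ), (log 4 * exp (-(x * t)) + exp (-(x * t)) * log t) := by
    refine setIntegral_congr_fun measurableSet_Ioi fun t ht => ?_
    rw [log_mul (by norm_num) (ne_of_gt ht)]
    ring
  rw [h, integral_add ((integrableOn_exp_neg_mul hx).const_mul _)
    (integrableOn_exp_neg_mul_log hx), integral_const_mul, integral_exp_neg_mul hx,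
    integral_exp_neg_mul_log hx]
  field_simp
  ring

lemma exp_mul_hankelPrimitive_eq (x t : ℝ) :
    ((exp (-(x * t)) : ℝ) : ℂ) * hankelPrimitive t =
      ((exp (-(x * t)) : ℝ) : ℂ) * hankelRemainder t
        - ((exp (-(x * t)) * log (4 * t) : ℝ) : ℂ) * Complex.I := by
  rw [hankelRemainder]
  push_cast
  ring

lemma integrableOn_exp_mul_hankelPrimitive {x : ℝ} (hx : 0 < x) :
    IntegrableOn (fun t : ℝ => ((exp (-(x * t)) : ℝ) : ℂ) * hankelPrimitive t) (Ioi 0) := by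
  simp_rw [exp_mul_hankelPrimitive_eq]
  exact (integrableOn_exp_mul_hankelRemainder hx).sub (integrableOn_ofReal_exp_mul_log_four hx)

lemma tendsto_exp_mul_hankelPrimitive {x : ℝ} (hx : 0 < x) :
    Tendsto (fun t : ℝ => ((exp (-(x * t)) : ℝ) : ℂ) * hankelPrimitive t) atTop (𝓝 0) := by
  have h1 : Tendsto (fun t : ℝ => 6 * (t ^ (1 : ℝ) * exp (-x * t))) atTop (𝓝 0) := by
    simpa using (tendsto_rpow_mul_exp_neg_mul_atTop_nhds_zero 1 x hx).const_mul 6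
  refine squeeze_zero_norm' ?_ h1
  filter_upwards [eventually_ge_atTop 1] with t ht
  have ht0 : 0 < t := one_pos.trans_le ht
  have h2 := norm_hankelPrimitive_add_log_le ht0
  have h3 : t ^ (-1 / 2 : ℝ) ≤ 1 := rpow_le_one_of_one_le_of_nonpos ht (by norm_num)
  have h4 : log (4 * t) ≤ 4 * t - 1 := log_le_sub_one_of_pos (by linarith)
  have h5 : 0 ≤ log (4 * t) := log_nonneg (by linarith)
  have h6 : ‖hankelPrimitive t‖ ≤ 2 + (4 * t - 1) := by
    have h := norm_sub_le (hankelPrimitive t + Complex.I * (log (4 * t) : ℂ))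
      (Complex.I * (log (4 * t) : ℂ))
    rw [add_sub_cancel_right, norm_mul, Complex.norm_I, one_mul, Complex.norm_real,
      norm_of_nonneg h5] at h
    linarith
  rw [norm_mul, Complex.norm_real, norm_of_nonneg (exp_pos _).le, rpow_one, ← neg_mul]
  nlinarith [exp_pos (-x * t)]

/-- Integration by parts against the primitive V gives x ∫ e^{-xt} V - V(0). Splitting off -i
log(4t) from V, the known transform of the logarithm combines with V(0) into π/2 + i(log(x/2) + γ).
-/
lemma hankelMoment_zero_eq {x : ℝ} (hx : 0 < x) :
    hankelMoment 0 x = (π : ℂ) / 2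
      + Complex.I * ((log (x / 2) : ℂ) + (eulerMascheroniConstant : ℂ))
      + (x : ℂ) * ∫ t in Ioi (0 : ℝ), ((exp (-(x * t)) : ℝ) : ℂ) * hankelRemainder t := by
  have hderiv : ∀ t ∈ Ioi (0 : ℝ), HasDerivAt
      (fun t : ℝ => ((exp (-(x * t)) : ℝ) : ℂ) * hankelPrimitive t)
      (-(x : ℂ) * (((exp (-(x * t)) : ℝ) : ℂ) * hankelPrimitive t)
        + ((t ^ 0 * exp (-(x * t)) : ℝ) : ℂ) * hankelWeight t) t := by
    intro t ht
    have h1 : HasDerivAt (fun t : ℝ => exp (-(x * t))) (exp (-(x * t)) * -(x * 1)) t :=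
      ((hasDerivAt_id t).const_mul x).neg.exp
    refine (h1.ofReal_comp.mul (hasDerivAt_hankelPrimitive ht)).congr_deriv ?_
    push_cast
    ring
  have hi1 := (integrableOn_exp_mul_hankelPrimitive hx).const_mul (-(x : ℂ))
  have hi2 := integrableOn_hankelMoment 0 hx
  have h := integral_Ioi_of_hasDerivAt_of_tendsto (a := 0) (m := 0)
    (Continuous.continuousWithinAt (by have := continuous_hankelPrimitive; fun_prop)) hderiv
    (hi1.add hi2) (tendsto_exp_mul_hankelPrimitive hx)
  rw [integral_add hi1 hi2, integral_const_mul] at h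
  simp_rw [exp_mul_hankelPrimitive_eq] at h
  rw [integral_sub (integrableOn_exp_mul_hankelRemainder hx)
    (integrableOn_ofReal_exp_mul_log_four hx), integral_mul_const,
    integral_complex_ofReal, integral_exp_mul_log_four hx, ← exp_mul_hankelPrimitive_eq,
    mul_zero, neg_zero, exp_zero, Complex.ofReal_one, one_mul, hankelPrimitive_zero] at h
  have hlog : log 4 = 2 * log 2 := by
    rw [show (4 : ℝ) = 2 ^ 2 by norm_num, log_pow]
    norm_num
  have hxC : (x : ℂ) ≠ 0 := Complex.ofReal_ne_zero.2 hx.ne'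
  rw [hlog] at h
  change _ + hankelMoment 0 x = _ at h
  rw [log_div hx.ne' two_ne_zero]
  generalize ∫ t in Ioi (0 : ℝ), ((exp (-(x * t)) : ℝ) : ℂ) * hankelRemainder t = A at h ⊢
  push_cast at h ⊢
  field_simp at h ⊢
  linear_combination h

/-- Integrate the t-derivative of e^{-xt} √t √(2i-t), whose boundary values vanish at 0 and ∞. With
√t √(2i-t) = t(2i-t)w and derivative (i-t)w, w being the weight, this is Bessel's equation in
Laplace form. -/
lemma hankelMoment_recurrence {x : ℝ} (hx : 0 < x) :
    (x : ℂ) * (hankelMoment 2 x - 2 * Complex.I * hankelMoment 1 x)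
      + Complex.I * hankelMoment 0 x - hankelMoment 1 x = 0 := by
  have hderiv : ∀ t ∈ Ioi (0 : ℝ), HasDerivAt
      (fun t : ℝ => ((exp (-(x * t)) : ℝ) : ℂ) * (((√t : ℝ) : ℂ) * hankelRoot t))
      ((x : ℂ) * (((t ^ 2 * exp (-(x * t)) : ℝ) : ℂ) * hankelWeight t
          - 2 * Complex.I * (((t ^ 1 * exp (-(x * t)) : ℝ) : ℂ) * hankelWeight t))
        + Complex.I * (((t ^ 0 * exp (-(x * t)) : ℝ) : ℂ) * hankelWeight t)
        - ((t ^ 1 * exp (-(x * t)) : ℝ) : ℂ) * hankelWeight t) t := by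
    intro t ht
    have ht : 0 < t := ht
    have h1 : HasDerivAt (fun t : ℝ => exp (-(x * t))) (exp (-(x * t)) * -(x * 1)) t :=
      ((hasDerivAt_id t).const_mul x).neg.exp
    have h2 := (hasDerivAt_sqrt ht.ne').ofReal_comp.mul (hasDerivAt_hankelRoot t)
    refine (h1.ofReal_comp.mul h2).congr_deriv ?_
    have h0 := hankelRoot_ne_zero t
    have hs : ((√t : ℝ) : ℂ) ≠ 0 := Complex.ofReal_ne_zero.2 (sqrt_pos.2 ht).ne'
    have hsq : ((√t : ℝ) : ℂ) ^ 2 = (t : ℂ) := by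
      rw [← Complex.ofReal_pow, sq_sqrt ht.le]
    have hr := hankelRoot_sq t
    rw [hankelWeight]
    simp only [Pi.mul_apply]
    push_cast
    rw [← hsq] at hr ⊢
    field_simp
    linear_combination (1 - 2 * x * ((√t : ℝ) : ℂ) ^ 2) * hr
  have hi1 := integrableOn_hankelMoment 1 hx
  have hi2 := integrableOn_hankelMoment 2 hx
  have hi0 : IntegrableOn (fun t : ℝ =>
      Complex.I * (((t ^ 0 * exp (-(x * t)) : ℝ) : ℂ) * hankelWeight t)) (Ioi 0) :=
    (integrableOn_hankelMoment 0 hx).const_mul _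
  have hi1' : IntegrableOn (fun t : ℝ =>
      2 * Complex.I * (((t ^ 1 * exp (-(x * t)) : ℝ) : ℂ) * hankelWeight t)) (Ioi 0) :=
    hi1.const_mul _
  have hi21 : IntegrableOn (fun t : ℝ =>
      (x : ℂ) * (((t ^ 2 * exp (-(x * t)) : ℝ) : ℂ) * hankelWeight t
        - 2 * Complex.I * (((t ^ 1 * exp (-(x * t)) : ℝ) : ℂ) * hankelWeight t))) (Ioi 0) :=
    (hi2.sub hi1').const_mul _
  have hi210 : IntegrableOn (fun t : ℝ =>
      (x : ℂ) * (((t ^ 2 * exp (-(x * t)) : ℝ) : ℂ) * hankelWeight t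
        - 2 * Complex.I * (((t ^ 1 * exp (-(x * t)) : ℝ) : ℂ) * hankelWeight t))
      + Complex.I * (((t ^ 0 * exp (-(x * t)) : ℝ) : ℂ) * hankelWeight t)) (Ioi 0) :=
    hi21.add hi0
  have hlim : Tendsto (fun t : ℝ => ((exp (-(x * t)) : ℝ) : ℂ) * (((√t : ℝ) : ℂ) * hankelRoot t))
      atTop (𝓝 0) := by
    have h1 : Tendsto (fun t : ℝ => 3 * (t ^ (2 : ℝ) * exp (-x * t))) atTop (𝓝 0) := by
      simpa using (tendsto_rpow_mul_exp_neg_mul_atTop_nhds_zero 2 x hx).const_mul 3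
    refine squeeze_zero_norm' ?_ h1
    filter_upwards [eventually_ge_atTop 1] with t ht
    have ht0 : 0 < t := one_pos.trans_le ht
    have h2 := norm_hankelRoot_le ht0
    have h3 : √t ≤ t := by rw [sqrt_le_left ht0.le]; nlinarith
    rw [norm_mul, norm_mul, Complex.norm_real, Complex.norm_real, norm_of_nonneg (exp_pos _).le,
      norm_of_nonneg (sqrt_nonneg t), rpow_two, ← neg_mul]
    calc exp (-x * t) * (√t * ‖hankelRoot t‖) ≤ exp (-x * t) * (t * (3 * t)) := by
          gcongr
          linarith
      _ = _ := by ring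
  have h := integral_Ioi_of_hasDerivAt_of_tendsto (a := 0) (m := 0)
    (Continuous.continuousWithinAt (by have := continuous_hankelRoot; fun_prop)) hderiv
    (hi210.sub hi1) hlim
  rw [integral_sub hi210 hi1, integral_add hi21 hi0, integral_const_mul,
    integral_sub hi2 hi1', integral_const_mul, integral_const_mul] at h
  simpa [hankelMoment] using h

/-! ### The Laplace integral solves the Bessel system. -/

/-- The Laplace representation `(2/π) e^{ix} ∫₀^∞ e^{-xt} / (√t √(2i - t)) dt`. -/
noncomputable def hankelLaplace (x : ℝ) : ℂ :=
  2 / (π : ℂ) * Complex.exp (Complex.I * x) * hankelMoment 0 x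

/-- The function `x F'(x)` for `F = hankelLaplace`. -/
noncomputable def hankelLaplaceFlux (x : ℝ) : ℂ :=
  2 / (π : ℂ) * Complex.exp (Complex.I * x) *
    (Complex.I * ((x : ℂ) * hankelMoment 0 x) - (x : ℂ) * hankelMoment 1 x)

lemma hasDerivAt_exp_I_mul (x : ℝ) :
    HasDerivAt (fun x : ℝ => 2 / (π : ℂ) * Complex.exp (Complex.I * x))
      (2 / (π : ℂ) * Complex.exp (Complex.I * x) * Complex.I) x := by
  refine ((((hasDerivAt_id x).ofReal_comp.const_mul Complex.I).cexp).const_mul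
    (2 / (π : ℂ))).congr_deriv ?_
  simp only [id, Complex.ofReal_one]
  ring

lemma hasDerivAt_hankelLaplace {x : ℝ} (hx : 0 < x) :
    HasDerivAt hankelLaplace (hankelLaplaceFlux x / x) x := by
  refine ((hasDerivAt_exp_I_mul x).mul (hasDerivAt_hankelMoment 0 hx)).congr_deriv ?_
  have hxC : (x : ℂ) ≠ 0 := Complex.ofReal_ne_zero.2 hx.ne'
  rw [hankelLaplaceFlux, eq_div_iff hxC]
  ring

lemma hasDerivAt_hankelLaplaceFlux {x : ℝ} (hx : 0 < x) :
    HasDerivAt hankelLaplaceFlux (-(x * hankelLaplace x)) x := by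
  have hid := (hasDerivAt_id x).ofReal_comp
  have h0 := (hid.mul (hasDerivAt_hankelMoment 0 hx)).const_mul Complex.I
  have h1 := hid.mul (hasDerivAt_hankelMoment 1 hx)
  refine ((hasDerivAt_exp_I_mul x).mul (h0.sub h1)).congr_deriv ?_
  simp only [hankelLaplace, Pi.sub_apply, Pi.mul_apply, id, Complex.ofReal_one, Nat.reduceAdd]
  have hrec := hankelMoment_recurrence hx
  linear_combination (2 / (π : ℂ) * Complex.exp (Complex.I * x)) * hrec
    + (2 / (π : ℂ) * Complex.exp (Complex.I * x)) * (x * hankelMoment 0 x) * Complex.I_sq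

/-- The leading behaviour of `H₀⁽¹⁾` at the origin. -/
noncomputable def hankelLeading (x : ℝ) : ℂ :=
  1 + 2 * Complex.I / (π : ℂ) * ((log (x / 2) : ℂ) + (eulerMascheroniConstant : ℂ))

lemma tendsto_hankelLaplace_sub_leading :
    Tendsto (fun x => hankelLaplace x - hankelLeading x) (𝓝[>] 0) (𝓝 0) := by
  -- The factor e^{ix} may be replaced by 1: (e^{ix} - 1)/x stays bounded while x times the zeroth
  -- moment tends to 0.
  have h1 : Tendsto (fun x : ℝ => (x : ℂ)⁻¹ * (2 / (π : ℂ) * Complex.exp (Complex.I * x)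
      - 2 / (π : ℂ))) (𝓝[>] 0) (𝓝 (2 / (π : ℂ) * Complex.I)) := by
    have h := (hasDerivAt_exp_I_mul 0).tendsto_slope_zero_right
    simpa using h
  have h2 := (h1.mul tendsto_id_mul_hankelMoment_zero).add ((tendsto_mul_laplace_zero
    (fun _ => norm_hankelPrimitive_add_log_le)).const_mul (2 / (π : ℂ)))
  simp only [mul_zero, add_zero] at h2
  refine h2.congr' ?_
  filter_upwards [self_mem_nhdsWithin] with x hx
  have hx : 0 < x := hx
  have hxC : (x : ℂ) ≠ 0 := Complex.ofReal_ne_zero.2 hx.ne'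
  have hpi : (π : ℂ) ≠ 0 := Complex.ofReal_ne_zero.2 pi_ne_zero
  have h := hankelMoment_zero_eq hx
  change _ = _ + (x : ℂ) * ∫ t in Ioi (0 : ℝ), ((exp (-(x * t)) : ℝ) : ℂ) *
    (hankelPrimitive t + Complex.I * (log (4 * t) : ℂ)) at h
  rw [← sub_eq_iff_eq_add'] at h
  rw [← h, hankelLaplace, hankelLeading]
  field_simp
  ring

lemma tendsto_hankelLaplaceFlux :
    Tendsto hankelLaplaceFlux (𝓝[>] 0) (𝓝 (2 * Complex.I / (π : ℂ))) := by
  have h0 : Tendsto (fun x : ℝ => 2 / (π : ℂ) * Complex.exp (Complex.I * x)) (𝓝[>] 0)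
      (𝓝 (2 / (π : ℂ))) := by
    have h := (hasDerivAt_exp_I_mul 0).continuousAt.tendsto
    simp only [Complex.ofReal_zero, mul_zero, Complex.exp_zero, mul_one] at h
    exact h.mono_left nhdsWithin_le_nhds
  have h := h0.mul ((tendsto_id_mul_hankelMoment_zero.const_mul Complex.I).sub
    tendsto_id_mul_hankelMoment_one)
  rw [show 2 / (π : ℂ) * (Complex.I * 0 - -Complex.I) = 2 * Complex.I / (π : ℂ) by ring] at h
  exact h

/-! ### Entire series with factorially bounded coefficients. -/

/-- The power series with coefficients `a`. -/
noncomputable def entireSeries (a : ℕ → ℂ) (z : ℂ) : ℂ := ∑' k, a k * z ^ k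

/-- Coefficients bounded by a multiple of `1 / k!`. -/
def FactorialBounded (a : ℕ → ℂ) : Prop := ∃ C : ℝ, ∀ k, ‖a k‖ ≤ C / k.factorial

namespace FactorialBounded

variable {a : ℕ → ℂ}

lemma shift (ha : FactorialBounded a) : FactorialBounded fun k => ((k : ℂ) + 1) * a (k + 1) := by
  obtain ⟨C, hC⟩ := ha
  refine ⟨C, fun k => ?_⟩
  have hk : ‖((k : ℂ) + 1)‖ = (k : ℝ) + 1 := by
    rw [← Nat.cast_succ, Complex.norm_natCast, Nat.cast_succ]
  have h := hC (k + 1)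
  rw [Nat.factorial_succ, Nat.cast_mul, Nat.cast_succ, mul_comm, ← div_div,
    le_div_iff₀ (by positivity)] at h
  rw [norm_mul, hk, mul_comm]
  exact h

lemma tail (ha : FactorialBounded a) : FactorialBounded fun k => a (k + 1) := by
  obtain ⟨C, hC⟩ := ha.shift
  refine ⟨C, fun k => le_trans ?_ (hC k)⟩
  have hk : ‖((k : ℂ) + 1)‖ = (k : ℝ) + 1 := by
    rw [← Nat.cast_succ, Complex.norm_natCast, Nat.cast_succ]
  rw [norm_mul, hk]
  nlinarith [norm_nonneg (a (k + 1)), k.cast_nonneg (α := ℝ)]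

lemma summable (ha : FactorialBounded a) (z : ℂ) : Summable fun k => a k * z ^ k := by
  obtain ⟨C, hC⟩ := ha
  refine Summable.of_norm_bounded ((summable_pow_div_factorial ‖z‖).mul_left C) fun k => ?_
  rw [norm_mul, norm_pow]
  calc ‖a k‖ * ‖z‖ ^ k ≤ C / k.factorial * ‖z‖ ^ k := by
        gcongr
        exact hC k
    _ = _ := by ring

lemma series_eq_add (ha : FactorialBounded a) (z : ℂ) :
    entireSeries a z = a 0 + z * entireSeries (fun k => a (k + 1)) z := by
  rw [entireSeries, (ha.summable z).tsum_eq_zero_add, pow_zero, mul_one, entireSeries,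
    ← tsum_mul_left]
  congr 2
  ext k
  ring

lemma hasDerivAt_series (ha : FactorialBounded a) (z : ℂ) :
    HasDerivAt (entireSeries a) (entireSeries (fun k => ((k : ℂ) + 1) * a (k + 1)) z) z := by
  obtain ⟨C, hC⟩ := ha.shift
  set R : ℝ := ‖z‖ + 1
  have hR : 0 < R := by positivity
  -- The constant term is split off so that exponents are k + 1 and every term vanishes at the base
  -- point 0. On the ball of radius ‖z‖ + 1 the derivatives are dominated by an exponential series.
  have h : HasDerivAt (fun w => ∑' k, a (k + 1) * w ^ (k + 1))
      (∑' k, a (k + 1) * (((k + 1 : ℕ) : ℂ) * z ^ k)) z := by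
    refine hasDerivAt_tsum_of_isPreconnected
      (g := fun k w => a (k + 1) * w ^ (k + 1))
      (g' := fun k w => a (k + 1) * (((k + 1 : ℕ) : ℂ) * w ^ k))
      (u := fun k : ℕ => C * (R ^ k / k.factorial)) (t := Metric.ball (0 : ℂ) R) (y₀ := 0)
      ((summable_pow_div_factorial R).mul_left C) Metric.isOpen_ball
      (convex_ball _ _).isPreconnected (fun k y _ => (hasDerivAt_pow (k + 1) y).const_mul _)
      (fun k y hy => ?_) (Metric.mem_ball_self hR) (by simp [summable_zero])
      (by simp [R])
    have hy : ‖y‖ ≤ R := by simpa using (Metric.mem_ball.1 hy).le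
    have h := hC k
    calc ‖a (k + 1) * (((k + 1 : ℕ) : ℂ) * y ^ k)‖
        = ‖((k : ℂ) + 1) * a (k + 1)‖ * ‖y‖ ^ k := by
          rw [← norm_pow, ← norm_mul]
          congr 1
          push_cast
          ring
      _ ≤ C / k.factorial * R ^ k :=
          mul_le_mul h (by gcongr) (by positivity) ((norm_nonneg _).trans h)
      _ = _ := by ring
  have heq : entireSeries a = fun w => a 0 + ∑' k, a (k + 1) * w ^ (k + 1) := by
    ext w
    rw [entireSeries, (ha.summable w).tsum_eq_zero_add, pow_zero, mul_one]
  rw [heq]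
  refine (h.const_add (a 0)).congr_deriv ?_
  rw [entireSeries]
  congr 1
  ext k
  push_cast
  ring

/-- The derivative of `x ↦ f(x²/4)` for an entire series `f`. -/
lemma hasDerivAt_series_sq (ha : FactorialBounded a) (x : ℝ) :
    HasDerivAt (fun x : ℝ => entireSeries a ((x : ℂ) ^ 2 / 4))
      (entireSeries (fun k => ((k : ℂ) + 1) * a (k + 1)) ((x : ℂ) ^ 2 / 4) * ((x : ℂ) / 2)) x := by
  have h1 : HasDerivAt (fun z : ℂ => z ^ 2 / 4) ((x : ℂ) / 2) (x : ℂ) := by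
    refine ((hasDerivAt_pow 2 (x : ℂ)).div_const 4).congr_deriv ?_
    norm_num
    ring
  exact ((ha.hasDerivAt_series ((x : ℂ) ^ 2 / 4)).comp (x : ℂ) h1).comp_ofReal

lemma tendsto_series_sq (ha : FactorialBounded a) :
    Tendsto (fun x : ℝ => entireSeries a ((x : ℂ) ^ 2 / 4)) (𝓝[>] 0) (𝓝 (a 0)) := by
  have h := (ha.hasDerivAt_series_sq 0).continuousAt.tendsto
  have h0 := ha.series_eq_add 0
  rw [zero_mul, add_zero] at h0
  simp only [Complex.ofReal_zero, ne_eq, OfNat.ofNat_ne_zero, not_false_eq_true, zero_pow,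
    zero_div, h0] at h
  exact h.mono_left nhdsWithin_le_nhds

end FactorialBounded

/-! ### The power series of the Hankel function solves the same system. -/

/-- The coefficients of `J₀` in powers of `x²/4`. -/
noncomputable def besselJCoeff (k : ℕ) : ℂ := (-1) ^ k / (k.factorial : ℂ) ^ 2

/-- The coefficients of the logarithm-free part of `Y₀` in powers of `x²/4`. -/
noncomputable def besselYCoeff (k : ℕ) : ℂ := (-1) ^ k * (harmonic k : ℂ) / (k.factorial : ℂ) ^ 2

lemma natCast_sq_le_two_mul_factorial (k : ℕ) : (k : ℝ) ^ 2 ≤ 2 * k.factorial := by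
  have h : k ^ 2 ≤ 2 * k.factorial := by
    cases k with
    | zero => simp
    | succ k =>
      rw [Nat.factorial_succ]
      have h1 := Nat.self_le_factorial k
      have h2 := Nat.factorial_pos k
      nlinarith
  exact_mod_cast h

lemma harmonic_nonneg (k : ℕ) : 0 ≤ harmonic k := by
  unfold harmonic
  positivity

lemma harmonic_le_natCast (k : ℕ) : (harmonic k : ℝ) ≤ k := by
  have h : harmonic k ≤ k := by
    induction k with
    | zero => simp
    | succ k ih =>
      rw [harmonic_succ]
      have : ((k + 1 : ℕ) : ℚ)⁻¹ ≤ 1 := inv_le_one_of_one_le₀ (by simp)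
      push_cast at this ⊢
      linarith
  exact_mod_cast h

/-- Since 1 + k² ≤ 3 k!, one factorial absorbs the polynomial. As H_k ≤ k, the numerator 1 + k²
covers all the factors 1, k, H_k and k H_k needed here. -/
lemma FactorialBounded.of_norm_le {a : ℕ → ℂ}
    (h : ∀ k, ‖a k‖ ≤ (1 + (k : ℝ) ^ 2) / (k.factorial : ℝ) ^ 2) : FactorialBounded a := by
  refine ⟨3, fun k => (h k).trans ?_⟩
  have h1 := natCast_sq_le_two_mul_factorial k
  have h2 : (1 : ℝ) ≤ k.factorial := by exact_mod_cast Nat.factorial_pos k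
  rw [div_le_div_iff₀ (by positivity) (by positivity)]
  nlinarith

lemma norm_harmonic (k : ℕ) : ‖(harmonic k : ℂ)‖ = (harmonic k : ℝ) := by
  rw [← Complex.ofReal_ratCast, Complex.norm_real, norm_of_nonneg]
  exact_mod_cast harmonic_nonneg k

lemma natCast_le_one_add_sq (k : ℕ) : (k : ℝ) ≤ 1 + (k : ℝ) ^ 2 := by
  nlinarith [sq_nonneg ((k : ℝ) - 1), k.cast_nonneg (α := ℝ)]

lemma factorialBounded_besselJCoeff : FactorialBounded besselJCoeff := by
  refine .of_norm_le fun k => ?_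
  simp only [besselJCoeff, norm_div, norm_pow, norm_neg, norm_one, one_pow, Complex.norm_natCast]
  gcongr
  nlinarith

lemma factorialBounded_mul_besselJCoeff : FactorialBounded fun k => (k : ℂ) * besselJCoeff k := by
  refine .of_norm_le fun k => ?_
  simp only [besselJCoeff, norm_mul, norm_div, norm_pow, norm_neg, norm_one, one_pow,
    Complex.norm_natCast, mul_one_div]
  gcongr
  exact natCast_le_one_add_sq k

lemma factorialBounded_besselYCoeff : FactorialBounded besselYCoeff := by
  refine .of_norm_le fun k => ?_
  simp only [besselYCoeff, norm_mul, norm_div, norm_pow, norm_neg, norm_one, one_pow,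
    Complex.norm_natCast, one_mul, norm_harmonic]
  gcongr
  exact (harmonic_le_natCast k).trans (natCast_le_one_add_sq k)

lemma factorialBounded_mul_besselYCoeff : FactorialBounded fun k => (k : ℂ) * besselYCoeff k := by
  refine .of_norm_le fun k => ?_
  simp only [besselYCoeff, norm_mul, norm_div, norm_pow, norm_neg, norm_one, one_pow,
    Complex.norm_natCast, one_mul, norm_harmonic, mul_div_assoc']
  gcongr
  nlinarith [harmonic_le_natCast k, k.cast_nonneg (α := ℝ)]

lemma besselJZero_eq_series (z : ℂ) : besselJZero z = entireSeries besselJCoeff (z ^ 2 / 4) := by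
  rw [besselJZero, entireSeries]
  congr 1
  ext k
  rw [besselJCoeff]
  ring

lemma hankelOneZero_eq_series {x : ℝ} (hx : 0 < x) :
    hankelOneZero x = entireSeries besselJCoeff ((x : ℂ) ^ 2 / 4) + 2 * Complex.I / (π : ℂ) *
      (((log (x / 2) : ℂ) + (eulerMascheroniConstant : ℂ)) *
        entireSeries besselJCoeff ((x : ℂ) ^ 2 / 4)
        - entireSeries besselYCoeff ((x : ℂ) ^ 2 / 4)) := by
  have h1 : ∑' k : ℕ, (-1 : ℂ) ^ k * (harmonic k : ℂ) * ((x : ℂ) ^ 2 / 4) ^ k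
      / ((k.factorial : ℂ) ^ 2) = entireSeries besselYCoeff ((x : ℂ) ^ 2 / 4) := by
    rw [entireSeries]
    congr 1
    ext k
    rw [besselYCoeff]
    ring
  have h2 : Complex.log ((x : ℂ) / 2) = (log (x / 2) : ℂ) := by
    rw [Complex.ofReal_log (by positivity)]
    push_cast
    rfl
  rw [hankelOneZero, besselYZero, besselJZero_eq_series, h1, h2]
  ring

/-- The function `x H'(x)` for `H = H₀⁽¹⁾`. -/
noncomputable def hankelFlux (x : ℝ) : ℂ :=
  2 * entireSeries (fun k => (k : ℂ) * besselJCoeff k) ((x : ℂ) ^ 2 / 4) +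
    2 * Complex.I / (π : ℂ) * (entireSeries besselJCoeff ((x : ℂ) ^ 2 / 4)
      + 2 * (((log (x / 2) : ℂ) + (eulerMascheroniConstant : ℂ)) *
        entireSeries (fun k => (k : ℂ) * besselJCoeff k) ((x : ℂ) ^ 2 / 4))
      - 2 * entireSeries (fun k => (k : ℂ) * besselYCoeff k) ((x : ℂ) ^ 2 / 4))

lemma FactorialBounded.series_mul_eq {a : ℕ → ℂ}
    (ha : FactorialBounded fun k => (k : ℂ) * a k) (z : ℂ) :
    entireSeries (fun k => (k : ℂ) * a k) z
      = z * entireSeries (fun k => ((k : ℂ) + 1) * a (k + 1)) z := by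
  rw [ha.series_eq_add z]
  simp

/-- Coefficient form of (z f')' = -f, which is Bessel's equation in the variable z = x²/4. -/
lemma shift_mul_besselJCoeff (k : ℕ) :
    ((k : ℂ) + 1) * (((k + 1 : ℕ) : ℂ) * besselJCoeff (k + 1)) = -besselJCoeff k := by
  have h1 : (k.factorial : ℂ) ≠ 0 := by exact_mod_cast k.factorial_ne_zero
  have h2 : (k : ℂ) + 1 ≠ 0 := by exact_mod_cast k.succ_ne_zero
  rw [besselJCoeff, besselJCoeff, Nat.factorial_succ]
  push_cast
  field_simp
  ring

/-- The increment 1/(k+1) of the harmonic number produces the extra J₀ term, which cancels the terms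
created by differentiating the logarithm in `hasDerivAt_hankelFlux`. -/
lemma shift_mul_besselYCoeff (k : ℕ) :
    ((k : ℂ) + 1) * (((k + 1 : ℕ) : ℂ) * besselYCoeff (k + 1))
      = -besselYCoeff k + ((k : ℂ) + 1) * besselJCoeff (k + 1) := by
  have h1 : (k.factorial : ℂ) ≠ 0 := by exact_mod_cast k.factorial_ne_zero
  have h2 : (k : ℂ) + 1 ≠ 0 := by exact_mod_cast k.succ_ne_zero
  rw [besselYCoeff, besselYCoeff, besselJCoeff, Nat.factorial_succ, harmonic_succ]
  push_cast
  field_simp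
  ring

lemma series_shift_mul_besselJCoeff (z : ℂ) :
    entireSeries (fun k => ((k : ℂ) + 1) * (((k + 1 : ℕ) : ℂ) * besselJCoeff (k + 1))) z
      = -entireSeries besselJCoeff z := by
  simp_rw [entireSeries, shift_mul_besselJCoeff, neg_mul, tsum_neg]

lemma series_shift_mul_besselYCoeff (z : ℂ) :
    entireSeries (fun k => ((k : ℂ) + 1) * (((k + 1 : ℕ) : ℂ) * besselYCoeff (k + 1))) z
      = -entireSeries besselYCoeff z
        + entireSeries (fun k => ((k : ℂ) + 1) * besselJCoeff (k + 1)) z := by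
  simp_rw [entireSeries, shift_mul_besselYCoeff, add_mul, neg_mul]
  have h1 := (factorialBounded_besselYCoeff.summable z).neg
  have h2 := factorialBounded_besselJCoeff.shift.summable z
  simp_rw [add_mul] at h2
  rw [h1.tsum_add h2, tsum_neg]

lemma hasDerivAt_log_half {x : ℝ} (hx : 0 < x) :
    HasDerivAt (fun x : ℝ => ((log (x / 2) : ℝ) : ℂ) + (eulerMascheroniConstant : ℂ))
      ((x : ℂ)⁻¹) x := by
  have h := (((hasDerivAt_id x).div_const 2).log (by simp [hx.ne'])).ofReal_comp.add_const
    (eulerMascheroniConstant : ℂ)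
  refine h.congr_deriv ?_
  simp only [id]
  rw [← Complex.ofReal_inv]
  congr 1
  field_simp

lemma hasDerivAt_hankelOneZero {x : ℝ} (hx : 0 < x) :
    HasDerivAt (fun x : ℝ => hankelOneZero x) (hankelFlux x / x) x := by
  have hJ := factorialBounded_besselJCoeff.hasDerivAt_series_sq x
  have hY := factorialBounded_besselYCoeff.hasDerivAt_series_sq x
  have h := hJ.add ((((hasDerivAt_log_half hx).mul hJ).sub hY).const_mul (2 * Complex.I / (π : ℂ)))
  have heq : (fun x : ℝ => hankelOneZero x) =ᶠ[𝓝 x] _ :=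
    (eventually_gt_nhds hx).mono fun y hy => hankelOneZero_eq_series hy
  refine (h.congr_of_eventuallyEq heq).congr_deriv ?_
  have hxC : (x : ℂ) ≠ 0 := Complex.ofReal_ne_zero.2 hx.ne'
  rw [hankelFlux, eq_div_iff hxC, factorialBounded_mul_besselJCoeff.series_mul_eq,
    factorialBounded_mul_besselYCoeff.series_mul_eq]
  field_simp
  ring

lemma hasDerivAt_hankelFlux {x : ℝ} (hx : 0 < x) :
    HasDerivAt hankelFlux (-(x * hankelOneZero x)) x := by
  have hJ := factorialBounded_besselJCoeff.hasDerivAt_series_sq x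
  have hQ := factorialBounded_mul_besselJCoeff.hasDerivAt_series_sq x
  have hR := factorialBounded_mul_besselYCoeff.hasDerivAt_series_sq x
  have h := (hQ.const_mul 2).add (((hJ.add (((hasDerivAt_log_half hx).mul hQ).const_mul 2)).sub
    (hR.const_mul 2)).const_mul (2 * Complex.I / (π : ℂ)))
  refine h.congr_deriv ?_
  have hxC : (x : ℂ) ≠ 0 := Complex.ofReal_ne_zero.2 hx.ne'
  rw [series_shift_mul_besselJCoeff, series_shift_mul_besselYCoeff,
    factorialBounded_mul_besselJCoeff.series_mul_eq, hankelOneZero_eq_series hx]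
  field_simp
  ring

lemma tendsto_log_mul_sq :
    Tendsto (fun x : ℝ => (((log (x / 2) : ℝ) : ℂ) + (eulerMascheroniConstant : ℂ))
      * ((x : ℂ) ^ 2 / 4)) (𝓝[>] 0) (𝓝 0) := by
  have h1 := tendsto_log_mul_rpow_nhdsGT_zero (r := 2) (by norm_num)
  have h2 : Tendsto (fun x : ℝ => x ^ 2) (𝓝[>] 0) (𝓝 0) := by
    have h : Tendsto (fun x : ℝ => x ^ 2) (𝓝 0) (𝓝 (0 ^ 2)) := (continuous_pow 2).tendsto 0
    simp only [ne_eq, OfNat.ofNat_ne_zero, not_false_eq_true, zero_pow] at h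
    exact h.mono_left nhdsWithin_le_nhds
  have h3 : Tendsto (fun x : ℝ => (log x * x ^ (2 : ℝ)
      + (eulerMascheroniConstant - log 2) * x ^ 2) / 4) (𝓝[>] 0) (𝓝 0) := by
    simpa using (h1.add (h2.const_mul (eulerMascheroniConstant - log 2))).div_const 4
  have h4 := (Complex.continuous_ofReal.tendsto 0).comp h3
  rw [Complex.ofReal_zero] at h4
  refine h4.congr' ?_
  filter_upwards [self_mem_nhdsWithin] with x hx
  have hx : 0 < x := hx
  simp only [Function.comp_apply, rpow_two, log_div hx.ne' two_ne_zero]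
  push_cast
  ring

/-- Once the leading logarithm is subtracted, every remaining logarithm multiplies a series without
constant term, hence carries a factor x²/4 that kills it. -/
lemma tendsto_log_mul_sq_mul_series {a : ℕ → ℂ} (ha : FactorialBounded a) :
    Tendsto (fun x : ℝ => (((log (x / 2) : ℝ) : ℂ) + (eulerMascheroniConstant : ℂ))
      * (((x : ℂ) ^ 2 / 4) * entireSeries a ((x : ℂ) ^ 2 / 4))) (𝓝[>] 0) (𝓝 0) := by
  have h := tendsto_log_mul_sq.mul ha.tendsto_series_sq
  rw [zero_mul] at h
  simpa only [mul_assoc] using h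

lemma besselJCoeff_zero : besselJCoeff 0 = 1 := by simp [besselJCoeff]

lemma besselYCoeff_zero : besselYCoeff 0 = 0 := by simp [besselYCoeff]

lemma tendsto_hankelOneZero_sub_leading :
    Tendsto (fun x : ℝ => hankelOneZero x - hankelLeading x) (𝓝[>] 0) (𝓝 0) := by
  have h1 := factorialBounded_besselJCoeff.tendsto_series_sq.sub_const 1
  have h2 := tendsto_log_mul_sq_mul_series factorialBounded_besselJCoeff.tail
  have h3 := factorialBounded_besselYCoeff.tendsto_series_sq
  have h := h1.add ((h2.sub h3).const_mul (2 * Complex.I / (π : ℂ)))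
  simp only [besselJCoeff_zero, besselYCoeff_zero, sub_self, mul_zero, add_zero] at h
  refine h.congr' ?_
  filter_upwards [self_mem_nhdsWithin] with x hx
  rw [hankelOneZero_eq_series hx, hankelLeading,
    factorialBounded_besselJCoeff.series_eq_add, besselJCoeff_zero]
  ring

lemma tendsto_hankelFlux :
    Tendsto hankelFlux (𝓝[>] 0) (𝓝 (2 * Complex.I / (π : ℂ))) := by
  have h1 := factorialBounded_mul_besselJCoeff.tendsto_series_sq
  have h2 := tendsto_log_mul_sq_mul_series factorialBounded_besselJCoeff.shift
  have h3 := factorialBounded_mul_besselYCoeff.tendsto_series_sq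
  have h4 := factorialBounded_besselJCoeff.tendsto_series_sq
  have h := (h1.const_mul 2).add (((h4.add (h2.const_mul 2)).sub (h3.const_mul 2)).const_mul
    (2 * Complex.I / (π : ℂ)))
  simp only [besselJCoeff_zero, Nat.cast_zero, zero_mul, sub_zero, mul_zero, add_zero,
    zero_add, mul_one, ← factorialBounded_mul_besselJCoeff.series_mul_eq] at h
  exact h

/-! ### The Laplace representation of the Hankel function. -/

theorem hankelOneZero_eq_hankelLaplace {x : ℝ} (hx : 0 < x) :
    hankelOneZero x = hankelLaplace x := by
  have h := besselSystem_unique (D := fun x : ℝ => hankelOneZero x - hankelLaplace x)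
    (P := fun x => hankelFlux x - hankelLaplaceFlux x) (fun x hx => ?_) (fun x hx => ?_) ?_ ?_ hx
  · exact sub_eq_zero.1 h
  · rw [sub_div]
    exact (hasDerivAt_hankelOneZero hx).sub (hasDerivAt_hankelLaplace hx)
  · refine ((hasDerivAt_hankelFlux hx).sub (hasDerivAt_hankelLaplaceFlux hx)).congr_deriv ?_
    ring
  · simpa using tendsto_hankelOneZero_sub_leading.sub tendsto_hankelLaplace_sub_leading
  · simpa using tendsto_hankelFlux.sub tendsto_hankelLaplaceFlux

/-! ### Fubini and the closed form. -/

/-- The two-variable integrand whose iterated integrals are the zeroth moment and its closed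
form. -/
noncomputable def hankelKernel (ω β : ℝ) (p : ℝ × ℝ) : ℂ :=
  2 / (π : ℂ) * Complex.exp (Complex.I * (β + 1) * ω * p.1) *
    (((exp (-(ω * p.1 * p.2)) : ℝ) : ℂ) * hankelWeight p.2)

lemma measurable_hankelKernel (ω β : ℝ) : Measurable (hankelKernel ω β) := by
  have := measurable_hankelWeight
  unfold hankelKernel
  fun_prop

lemma norm_hankelKernel_le (ω β x : ℝ) {t : ℝ} (ht : 0 < t) :
    ‖hankelKernel ω β (x, t)‖ ≤ 2 / π * (t ^ ((1 / 2 : ℝ) - 1) * exp (-(ω * x * t))) := by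
  have h1 : ‖Complex.exp (Complex.I * (β + 1) * ω * x)‖ = 1 := by
    rw [show Complex.I * (β + 1) * ω * x = (((β + 1) * ω * x : ℝ) : ℂ) * Complex.I by
      push_cast; ring, Complex.norm_exp_ofReal_mul_I]
  rw [hankelKernel, norm_mul, norm_mul, norm_mul, h1, norm_div, Complex.norm_ofNat,
    Complex.norm_real, Complex.norm_real, norm_of_nonneg pi_pos.le, norm_of_nonneg (exp_pos _).le,
    mul_one, mul_comm (exp _), show (1 / 2 : ℝ) - 1 = -1 / 2 by norm_num]
  gcongr
  exact norm_hankelWeight_le ht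

lemma integrable_hankelKernel_section {ω β x : ℝ} (hω : 0 < ω) (hx : 0 < x) :
    Integrable (fun t => hankelKernel ω β (x, t)) (volume.restrict (Ioi 0)) := by
  refine ((integrableOn_rpow_mul_exp_neg_mul (a := (1 / 2 : ℝ) - 1) (by norm_num)
    (mul_pos hω hx)).const_mul (2 / π)).mono'
    ((measurable_hankelKernel ω β).comp measurable_prodMk_left).aestronglyMeasurable ?_
  filter_upwards [ae_restrict_mem measurableSet_Ioi] with t ht
  exact norm_hankelKernel_le ω β x ht

/-- The oscillating factor has modulus 1, so the t-integral of the norm is at most a constant times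
x^{-1/2}, which is integrable on (0,1]. -/
lemma integrable_hankelKernel {ω β : ℝ} (hω : 0 < ω) :
    Integrable (hankelKernel ω β)
      ((volume.restrict (Ioc 0 1)).prod (volume.restrict (Ioi 0))) := by
  have hm := (measurable_hankelKernel ω β).aestronglyMeasurable
    (μ := (volume.restrict (Ioc 0 1)).prod (volume.restrict (Ioi 0)))
  refine (integrable_prod_iff hm).2 ⟨?_, ?_⟩
  · filter_upwards [ae_restrict_mem measurableSet_Ioc] with x hx
    exact integrable_hankelKernel_section hω hx.1
  · have hi : Integrable (fun x : ℝ => 2 / π * ω ^ (-1 / 2 : ℝ) * Gamma (1 / 2) *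
        x ^ (-1 / 2 : ℝ)) (volume.restrict (Ioc 0 1)) := by
      have h := intervalIntegral.intervalIntegrable_rpow' (a := 0) (b := 1) (r := -1 / 2)
        (by norm_num)
      rw [intervalIntegrable_iff_integrableOn_Ioc_of_le zero_le_one] at h
      exact h.const_mul _
    refine hi.mono' hm.norm.integral_prod_right' ?_
    filter_upwards [ae_restrict_mem measurableSet_Ioc] with x hx
    have hx0 : 0 < x := hx.1
    have hωx := mul_pos hω hx0
    rw [norm_of_nonneg (integral_nonneg fun _ => norm_nonneg _)]
    have h : ∫ t in Ioi (0 : ℝ), ‖hankelKernel ω β (x, t)‖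
        ≤ ∫ t in Ioi (0 : ℝ), 2 / π * (t ^ ((1 / 2 : ℝ) - 1) * exp (-(ω * x * t))) := by
      refine setIntegral_mono_on (integrable_hankelKernel_section hω hx0).norm
        ((integrableOn_rpow_mul_exp_neg_mul (by norm_num) hωx).const_mul _) measurableSet_Ioi
        fun t ht => norm_hankelKernel_le ω β x ht
    rw [integral_const_mul, integral_rpow_mul_exp_neg_mul_Ioi (by norm_num) hωx] at h
    refine h.trans_eq ?_
    rw [one_div, inv_rpow hωx.le, ← rpow_neg hωx.le, mul_rpow hω.le hx0.le,
      show (-1 / 2 : ℝ) = -2⁻¹ by norm_num]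
    ring_nf

lemma integral_hankelKernel_right {ω β x : ℝ} (hω : 0 < ω) (hx : 0 < x) :
    ∫ t in Ioi (0 : ℝ), hankelKernel ω β (x, t) = momentIntegrand 0 ω β x := by
  have h1 : ∫ t in Ioi (0 : ℝ), hankelKernel ω β (x, t)
      = 2 / (π : ℂ) * Complex.exp (Complex.I * (β + 1) * ω * x) * hankelMoment 0 (ω * x) := by
    simp only [hankelKernel, hankelMoment, pow_zero, one_mul]
    rw [integral_const_mul]
  have h2 : Complex.exp (Complex.I * (β + 1) * ω * x)
      = Complex.exp (Complex.I * ((ω * x : ℝ) : ℂ)) * Complex.exp (Complex.I * ω * β * x) := by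
    rw [← Complex.exp_add]
    congr 1
    push_cast
    ring
  rw [h1, h2, momentIntegrand, ← Complex.ofReal_mul,
    hankelOneZero_eq_hankelLaplace (mul_pos hω hx), hankelLaplace, Nat.cast_zero, Polynomial.Chebyshev.T_zero,
    Polynomial.eval_one, Complex.ofReal_one]
  ring

lemma integral_hankelKernel_left {ω β t : ℝ} (hω : 0 < ω) (ht : 0 < t) :
    ∫ x in Ioc (0 : ℝ) 1, hankelKernel ω β (x, t)
      = -(2 * Complex.I / (π : ℂ)) * (ω : ℂ)⁻¹ * closedFormIntegrand ω β t := by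
  -- The exponent rate in x. It is nonzero for every real β because 1 + β + it has imaginary part t
  -- > 0.
  set c : ℂ := Complex.I * ω * (1 + β + Complex.I * t) with hc
  have hd : (1 : ℂ) + β + Complex.I * t ≠ 0 := fun h => by
    have := congrArg Complex.im h
    simp at this
    exact ht.ne' this
  have hωC : (ω : ℂ) ≠ 0 := Complex.ofReal_ne_zero.2 hω.ne'
  have hc0 : c ≠ 0 := mul_ne_zero (mul_ne_zero Complex.I_ne_zero hωC) hd
  have h1 : ∀ x : ℝ, hankelKernel ω β (x, t)
      = 2 / (π : ℂ) * hankelWeight t * Complex.exp (c * x) := by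
    intro x
    rw [hankelKernel, Complex.ofReal_exp,
      show c * x = Complex.I * (β + 1) * ω * x + ((-(ω * x * t) : ℝ) : ℂ) by
        rw [hc]; push_cast; linear_combination (ω * x * t : ℂ) * Complex.I_sq, Complex.exp_add]
    ring
  have h2 : Complex.exp (c * (1 : ℝ))
      = Complex.exp (Complex.I * (β + 1) * ω) * Complex.exp (-(t : ℂ) * ω) := by
    rw [← Complex.exp_add, hc]
    congr 1
    push_cast
    linear_combination (ω * t : ℂ) * Complex.I_sq
  simp_rw [h1]
  rw [integral_const_mul, ← intervalIntegral.integral_of_le zero_le_one, integral_exp_mul_complex hc0,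
    h2, Complex.ofReal_zero, mul_zero, Complex.exp_zero, closedFormIntegrand]
  change _ = _ * (_ * (_ / (hankelRoot t * _)))
  have h0 := hankelRoot_ne_zero t
  have hs : ((√t : ℝ) : ℂ) ≠ 0 := Complex.ofReal_ne_zero.2 (sqrt_pos.2 ht).ne'
  rw [hankelWeight, hc]
  generalize Complex.exp (Complex.I * (β + 1) * ω) * Complex.exp (-(t : ℂ) * ω) - 1 = A
  have hI := Complex.I_ne_zero
  have hpi : (π : ℂ) ≠ 0 := Complex.ofReal_ne_zero.2 pi_ne_zero
  field_simp
  linear_combination A * Complex.I_sq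

theorem mainTheorem4 (ω β : ℝ) (hω : 0 < ω) :
    IntervalIntegrable (momentIntegrand 0 ω β) MeasureTheory.volume 0 1 ∧
    MeasureTheory.IntegrableOn (closedFormIntegrand ω β) (Set.Ioi 0) MeasureTheory.volume ∧
    chebyshevMoment 0 ω β =
      -(2 * Complex.I / (Real.pi : ℂ)) * (ω : ℂ)⁻¹ *
        ∫ t in Set.Ioi (0 : ℝ), closedFormIntegrand ω β t := by
  have hK := integrable_hankelKernel (β := β) hω
  have hc : -(2 * Complex.I / (Real.pi : ℂ)) * (ω : ℂ)⁻¹ ≠ 0 := by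
    simp [hω.ne', pi_ne_zero]
  have hleft : ∀ᵐ x ∂volume.restrict (Ioc (0 : ℝ) 1),
      ∫ t in Ioi (0 : ℝ), hankelKernel ω β (x, t) = momentIntegrand 0 ω β x := by
    filter_upwards [ae_restrict_mem measurableSet_Ioc] with x hx
    exact integral_hankelKernel_right hω hx.1
  have hright : ∀ᵐ t ∂volume.restrict (Ioi (0 : ℝ)),
      ∫ x in Ioc (0 : ℝ) 1, hankelKernel ω β (x, t)
        = -(2 * Complex.I / (π : ℂ)) * (ω : ℂ)⁻¹ * closedFormIntegrand ω β t := by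
    filter_upwards [ae_restrict_mem measurableSet_Ioi] with t ht
    exact integral_hankelKernel_left hω ht
  refine ⟨?_, ?_, ?_⟩
  · rw [intervalIntegrable_iff_integrableOn_Ioc_of_le zero_le_one]
    exact hK.integral_prod_left.congr hleft
  -- Fubini gives integrability of a constant multiple of the closed-form integrand; the constant is
  -- nonzero and is divided out.
  · have h := (hK.integral_prod_right.congr hright).const_mul
      (-(2 * Complex.I / (π : ℂ)) * (ω : ℂ)⁻¹)⁻¹
    simp only [inv_mul_cancel_left₀ hc] at h
    exact h
  · rw [chebyshevMoment, intervalIntegral.integral_of_le zero_le_one, ← integral_congr_ae hleft,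
      ← integral_const_mul, ← integral_congr_ae hright]
    exact integral_integral_swap (f := fun x t => hankelKernel ω β (x, t)) hK
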